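/- Let $\mathcal M=(E,\mathcal B)$ be a matroid on a finite ground set $E$, given by its set of bases $\mathcal B$, and let $r$ be its rank. For $\mathbb F\in\{\mathbb R,\mathbb C\}$ identify each $e\in E$ with the corresponding standard unit vector of $\ell^2(E;\mathbb F)$, and for a subspace $H\subseteq\ell^2(E;\mathbb F)$ let $P_H$ be the orthogonal projection onto $H$. We say that $H$ *represents* $\mathcal M$ if, for every $r$-element set $B\subseteq E$, one has $B\in\mathcal B$ if and only if the vectors $P_He$ $(e\in B)$ form a basis of $H$. Let $\mathbf P^H$ be the determinantal probability measure on subsets of $E$ associated with $H$: if $v_1,\dots,v_k$ is an orthonormal basis of $H$, then $\mathbf P^H[\{e_1,\dots,e_k\}]=|\det[(v_i,e_j)]_{i,j\le k}|^2$ for distinct $e_1,\dots,e_k\in E$, and all subsets whose cardinality is not $k=\dim H$ have probability $0$. A *coordinatization matrix* of $\mathcal M$ over a field $F$ is a matrix over $F$ with columns indexed by $E$ such that a set $I\subseteq E$ is independent in $\mathcal M$ if and only if the columns indexed by $I$ are linearly independent. The matroid $\mathcal M$ is *regular* if it has a coordinatization matrix over every field. It is *complex unimodular* if it has a coordinatization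 matrix $A$ over $\mathbb C$ with $r$ rows such that $|\det A_B|=1$ for every $B\in\mathcal B$, where $A_B$ is the $r\times r$ submatrix of the columns indexed by $B$. Then: 1. there is a subspace $H\subseteq\ell^2(E;\mathbb R)$ that represents $\mathcal M$ and for which $\mathbf P^H$ is the uniform measure on $\mathcal B$ if and only if $\mathcal M$ is regular; 2. there is a subspace $H\subseteq\ell^2(E;\mathbb C)$ that represents $\mathcal M$ and for which $\mathbf P^H$ is the uniform measure on $\mathcal B$ if and only if $\mathcal M$ is complex unimodular. -/

import Mathlib

open MeasureTheory ProbabilityTheory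
open scoped InnerProductSpace

universe u v

noncomputable section

namespace DetProb

/-- The standard basis vector of `ℓ²(E; 𝕜)` attached to `e ∈ E`. -/
def unitVec (𝕜 : Type*) [RCLike 𝕜] {E : Type*} [Fintype E] [DecidableEq E] (e : E) :
    EuclideanSpace 𝕜 E :=
  EuclideanSpace.single e 1

/-- The subspace `H ⊆ ℓ²(E; 𝕜)` represents the matroid `M` of rank `r` on `E`: an `r`-element
set `B ⊆ E` is a base of `M` iff the projections `P_H e` (`e ∈ B`) form a basis of `H`. -/
def Represents {𝕜 : Type*} [RCLike 𝕜] {E : Type*} [Fintype E] [DecidableEq E]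
    (H : Submodule 𝕜 (EuclideanSpace 𝕜 E)) (M : Matroid E) : Prop :=
  ∀ B : Finset E, (B.card : ℕ∞) = M.eRank →
    (M.IsBase (B : Set E) ↔
      LinearIndepOn 𝕜 (fun e => H.starProjection (unitVec 𝕜 e)) (B : Set E) ∧
      Submodule.span 𝕜 ((fun e => H.starProjection (unitVec 𝕜 e)) '' (B : Set E)) = H)

/-- The weight `P^H[B] = |(ξ_H, θ_B)|²`, where `ξ_H = v₁ ∧ ⋯ ∧ v_r` for an orthonormal basis
`v₁, …, v_r` of `H` and `θ_B = e₁ ∧ ⋯ ∧ e_r` when `B = {e₁, …, e_r}`; the inner product of these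
two multivectors is the determinant of the matrix of inner products `(v_i, e_j)`. The weight does
not depend on the orthonormal basis or on the enumeration of `B`, and it is `0` if `B` does not
have exactly `dim H` elements. -/
def weight {𝕜 : Type*} [RCLike 𝕜] {E : Type*} [Fintype E] [DecidableEq E]
    (H : Submodule 𝕜 (EuclideanSpace 𝕜 E)) (B : Finset E) : ℝ :=
  if h : B.card = Module.finrank 𝕜 H then
    ‖(Matrix.of fun i j : Fin (Module.finrank 𝕜 H) =>
      ⟪(stdOrthonormalBasis 𝕜 H i : EuclideanSpace 𝕜 E),
        unitVec 𝕜 ((B.equivFinOfCardEq h).symm j : E)⟫_𝕜).det‖ ^ 2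
  else 0

/-- The determinantal probability measure `P^H` on the subsets of `E`. -/
def detMeasure {𝕜 : Type*} [RCLike 𝕜] {E : Type*} [Fintype E] [DecidableEq E]
    (H : Submodule 𝕜 (EuclideanSpace 𝕜 E)) : Measure (Set E) :=
  ∑ B : Finset E, ENNReal.ofReal (weight H B) • Measure.dirac (B : Set E)

/-- `A` is a coordinatization matrix of `M` over `F`: its columns represent `M`. -/
def IsCoordinatization {F : Type*} [Field F] {E : Type*} {s : ℕ}
    (A : Matrix (Fin s) E F) (M : Matroid E) : Prop :=
  ∀ I : Set E, M.Indep I ↔ LinearIndepOn F A.col I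

/-- `M` is representable over the field `F`. -/
def IsRepresentableOver (F : Type*) [Field F] {E : Type*} (M : Matroid E) : Prop :=
  ∃ (s : ℕ) (A : Matrix (Fin s) E F), IsCoordinatization A M

/-- A matroid is regular if it is representable over every field. -/
def IsRegular {E : Type u} (M : Matroid E) : Prop :=
  ∀ (F : Type v) [Field F], IsRepresentableOver F M

/-- A matroid of rank `r` is complex unimodular if it has a coordinatization matrix over `ℂ` with
`r` rows such that the `r × r` submatrix of columns indexed by any base (in any order) has a
determinant of absolute value `1`. -/
def IsComplexUnimodular {E : Type*} (M : Matroid E) : Prop :=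
  ∃ (r : ℕ) (A : Matrix (Fin r) E ℂ), M.eRank = r ∧ IsCoordinatization A M ∧
    ∀ b : Fin r ↪ E, M.IsBase (Set.range b) → ‖(A.submatrix id b).det‖ = 1

end DetProb

end

/-! ### Coordinatization matrices and their maximal minors -/

section Coordinatization

variable {F : Type*} [Field F] {E : Type*} {r : ℕ}

/-! An orthonormal basis of `H` gives a matrix `frameMatrix H` whose columns are the coordinates of
the projections `P_H e`. Hence `H` represents `M` exactly when `dim H = r` and this matrix
coordinatizes `M` (`represents_iff`), and the weight of `B` is the squared modulus of its minor on
`B`. Cauchy–Binet makes the weights sum to 1, so the measure is uniform on bases iff all base minors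
have the same modulus. Multiplying by the inverse of one base submatrix makes that modulus 1;
conversely, the frame matrix of the conjugated row space of a unimodular `A` is `T * A` with `T`
invertible, so all its base minors have modulus `|det T|`. This argument is the same over ℝ and ℂ
and settles the complex case.

Over ℝ it remains to see that unimodular means regular. A unimodular matrix normalized to the
identity on a base has integer entries and minors in {0, 1, -1}, so it can be reduced into any
field. Conversely, representations over the fields with 2 and 3 elements suffice: in standard form
on a common base they have the same support, and the ternary one lifts to entries in {0, 1, -1}.
Pivoting preserves this shape, because an entry ±2 would vanish mod 2 but not mod 3
(`IsSignedLift.pivot`); induction on pivots then bounds all minors by 1 (`IsSignedLift.abs_det_le`).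
-/

theorem linearIndepOn_col_range_iff (A : Matrix (Fin r) E F) (b : Fin r ↪ E) :
    LinearIndepOn F A.col (Set.range b) ↔ (A.submatrix id b).det ≠ 0 := by
  rw [linearIndepOn_range_iff b.injective, ← isUnit_iff_ne_zero, ← Matrix.isUnit_iff_isUnit_det,
    ← Matrix.linearIndependent_cols_iff_isUnit]
  rfl

theorem encard_range_embedding (b : Fin r ↪ E) : (Set.range b).encard = r := by
  rw [← Set.image_univ, b.injective.encard_image]
  simp

theorem exists_embedding_range_eq {B : Set E} (h : B.encard = r) :
    ∃ b : Fin r ↪ E, Set.range b = B := by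
  have hfin : B.Finite := Set.finite_of_encard_eq_coe h
  have : Fintype B := hfin.fintype
  have hc : Fintype.card B = r := by
    rw [Set.encard_eq_coe_toFinset_card] at h
    rw [← Set.toFinset_card]
    exact_mod_cast h
  let e := (Fintype.equivFinOfCardEq hc).symm
  refine ⟨e.toEmbedding.trans (Function.Embedding.subtype _), ?_⟩
  ext x
  simp only [Set.mem_range, Function.Embedding.trans_apply, Equiv.toEmbedding_apply,
    Function.Embedding.subtype_apply]
  constructor
  · rintro ⟨i, rfl⟩
    exact (e i).2
  · intro hx
    exact ⟨e.symm ⟨x, hx⟩, by simp⟩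

theorem Matroid.IsBase.exists_embedding {M : Matroid E} (hr : M.eRank = r) {B : Set E}
    (hB : M.IsBase B) : ∃ b : Fin r ↪ E, Set.range b = B :=
  exists_embedding_range_eq (hB.encard_eq_eRank.trans hr)

theorem Matroid.isBase_range_iff_indep {M : Matroid E} (hr : M.eRank = r) (b : Fin r ↪ E) :
    M.IsBase (Set.range b) ↔ M.Indep (Set.range b) := by
  refine ⟨fun h => h.indep, fun h => h.isBase_of_eRk_ge (Set.finite_range b) ?_⟩
  rw [h.eRk_eq_encard, encard_range_embedding, hr]

theorem DetProb.IsCoordinatization.isBase_range_iff {M : Matroid E} {A : Matrix (Fin r) E F}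
    (hA : DetProb.IsCoordinatization A M) (hr : M.eRank = r) (b : Fin r ↪ E) :
    M.IsBase (Set.range b) ↔ (A.submatrix id b).det ≠ 0 := by
  rw [Matroid.isBase_range_iff_indep hr, hA, linearIndepOn_col_range_iff]

/-- Both independence systems are determined by their `r`-element members. Some base minor is
nonzero, so the columns span the whole space and every independent set of columns extends to one of
size `r`. -/
theorem DetProb.isCoordinatization_of_isBase_range_iff {M : Matroid E} {A : Matrix (Fin r) E F}
    (hr : M.eRank = r)
    (h : ∀ b : Fin r ↪ E, M.IsBase (Set.range b) ↔ (A.submatrix id b).det ≠ 0) :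
    DetProb.IsCoordinatization A M := by
  intro I
  constructor
  · intro hI
    obtain ⟨B, hB, hIB⟩ := hI.exists_isBase_superset
    obtain ⟨b, rfl⟩ := hB.exists_embedding hr
    exact ((linearIndepOn_col_range_iff A b).2 ((h b).1 hB)).mono hIB
  · intro hI
    obtain ⟨B₀, hB₀⟩ := M.exists_isBase
    obtain ⟨b₀, rfl⟩ := hB₀.exists_embedding hr
    have h₀ := (linearIndepOn_col_range_iff A b₀).2 ((h b₀).1 hB₀)
    obtain ⟨B, -, hIB, hsp, hB⟩ := exists_linearIndepOn_extension hI (Set.subset_univ I)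
    have hli₀ : LinearIndependent F (A.col ∘ b₀) := (linearIndepOn_range_iff b₀.injective _).1 h₀
    have htop : Submodule.span F (Set.range (A.col ∘ b₀)) = ⊤ :=
      hli₀.span_eq_top_of_card_eq_finrank' (by simp)
    have hspan : Submodule.span F (A.col '' B) = ⊤ := by
      rw [eq_top_iff, ← htop, Submodule.span_le]
      rintro _ ⟨i, rfl⟩
      exact hsp ⟨b₀ i, trivial, rfl⟩
    have hfin : B.Finite := by
      have : Finite B := LinearIndependent.finite hB
      exact Set.toFinite B
    have : Fintype B := hfin.fintype
    have hcard : B.encard = r := by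
      have hs : Submodule.span F (Set.range fun x : B => A.col x) = ⊤ := by
        rw [← hspan]; congr 1; ext; simp
      have := Module.finrank_eq_card_basis (Module.Basis.mk hB hs.ge)
      rw [Set.encard_eq_coe_toFinset_card, Set.toFinset_card, ← this]
      simp
    obtain ⟨b, rfl⟩ := exists_embedding_range_eq hcard
    exact ((h b).2 ((linearIndepOn_col_range_iff A b).1 hB)).indep.subset hIB

/-- Left multiplication by an invertible matrix preserves coordinatizations. -/
theorem DetProb.IsCoordinatization.mul_left {M : Matroid E} {A : Matrix (Fin r) E F}
    (hA : DetProb.IsCoordinatization A M) (hr : M.eRank = r) {U : Matrix (Fin r) (Fin r) F}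
    (hU : U.det ≠ 0) : DetProb.IsCoordinatization (U * A) M := by
  refine DetProb.isCoordinatization_of_isBase_range_iff hr fun b => ?_
  have : (U * A).submatrix id b = U * A.submatrix id b := rfl
  rw [this, Matrix.det_mul, hA.isBase_range_iff hr]
  simp [hU]

/-- A representable matroid has a coordinatization matrix which is the identity on a base. -/
theorem DetProb.IsRepresentableOver.exists_standard {M : Matroid E}
    (h : DetProb.IsRepresentableOver F M) (b : Fin r ↪ E)
    (hb : M.IsBase (Set.range b)) :
    ∃ A : Matrix (Fin r) E F, DetProb.IsCoordinatization A M ∧ A.submatrix id b = 1 := by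
  obtain ⟨s, A, hA⟩ := h
  have hli : LinearIndependent F (A.col ∘ b) :=
    (linearIndepOn_range_iff b.injective _).1 ((hA _).1 hb.indep)
  -- A column outside this span could be added to the base, against maximality. So `r` coordinates
  -- suffice even if `A` has more rows.
  have hmem : ∀ e, A.col e ∈ Submodule.span F (Set.range (A.col ∘ b)) := by
    intro e
    by_cases he : e ∈ Set.range b
    · obtain ⟨i, rfl⟩ := he
      exact Submodule.subset_span ⟨i, rfl⟩
    · by_contra hcon
      have h1 : LinearIndepOn F A.col (insert e (Set.range b)) :=
        ((hA _).1 hb.indep).insert (by rwa [← Set.range_comp])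
      exact he (hb.mem_of_insert_indep ((hA _).2 h1))
  let β := Module.Basis.span hli
  let φ : E → Submodule.span F (Set.range (A.col ∘ b)) := fun e => ⟨A.col e, hmem e⟩
  let C : Matrix (Fin r) E F := Matrix.of fun i e => β.repr (φ e) i
  have hC : ∀ e, C.col e = (β.equivFun.toLinearMap) (φ e) := fun e => by ext; simp [C]
  refine ⟨C, fun I => ?_, ?_⟩
  · rw [hA]
    have h1 : C.col = β.equivFun.toLinearMap ∘ φ := funext hC
    have h2 : A.col = (Submodule.span F (Set.range (A.col ∘ b))).subtype ∘ φ := rfl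
    unfold LinearIndepOn
    rw [h1]
    conv_lhs => rw [h2]
    exact ((LinearMap.linearIndependent_iff (v := fun x : I => φ x) _ (Submodule.ker_subtype _))).trans
      (LinearMap.linearIndependent_iff (v := fun x : I => φ x) _ (LinearEquiv.ker _)).symm
  · ext i j
    have : φ (b j) = β j := by
      apply Subtype.ext
      simp [φ, β, Module.Basis.span_apply]
    simp [C, this, Matrix.one_apply, Finsupp.single_apply, eq_comm]

end Coordinatization

/-! ### Regular matroids and totally unimodular matrices -/

section Regular

variable {E : Type*} {r : ℕ}

theorem DetProb.IsCoordinatization.det_submatrix_ne_zero_iff {F : Type*} [Field F] {M : Matroid E}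
    {A : Matrix (Fin r) E F} (hA : DetProb.IsCoordinatization A M) (hr : M.eRank = r)
    (g : Fin r → E) :
    (A.submatrix id g).det ≠ 0 ↔ Function.Injective g ∧ M.IsBase (Set.range g) := by
  by_cases hg : Function.Injective g
  · simpa [hg] using (hA.isBase_range_iff hr ⟨g, hg⟩).symm
  · simp only [hg, false_and, iff_false, not_not]
    simp only [Function.Injective, not_forall] at hg
    obtain ⟨i, j, hij, hne⟩ := hg
    exact Matrix.det_zero_of_column_eq hne fun k => by simp [hij]

theorem DetProb.IsCoordinatization.map {F K : Type*} [Field F] [Field K] {M : Matroid E}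
    {A : Matrix (Fin r) E F} (hA : DetProb.IsCoordinatization A M) (hr : M.eRank = r)
    (f : F →+* K) : DetProb.IsCoordinatization (A.map f) M := by
  refine DetProb.isCoordinatization_of_isBase_range_iff hr fun b => ?_
  have : (A.map f).submatrix id b = f.mapMatrix (A.submatrix id b) := rfl
  rw [this, ← RingHom.map_det, hA.isBase_range_iff hr, map_ne_zero]

/-- If `A` is the identity on `b`, then exchanging `b i` for `e` gives a minor equal to the
entry `A i e`. -/
theorem Matrix.det_submatrix_update {R : Type*} [CommRing R] [DecidableEq E]
    {A : Matrix (Fin r) E R} {b : Fin r → E} (hb : A.submatrix id b = 1) (i : Fin r) (e : E) :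
    (A.submatrix id (Function.update b i e)).det = A i e := by
  have : A.submatrix id (Function.update b i e) = (1 : Matrix (Fin r) (Fin r) R).updateCol i
      (A.col e) := by
    ext k l
    rw [← hb]
    by_cases h : l = i
    · subst h; simp
    · simp [h]
  rw [this, ← Matrix.cramer_apply, Matrix.cramer_one]
  rfl

/-- The right-hand side does not involve the field, so matrices in standard form on the same base
have the same support over any two fields. -/
theorem DetProb.IsCoordinatization.apply_ne_zero_iff {F : Type*} [Field F] [DecidableEq E]
    {M : Matroid E} {A : Matrix (Fin r) E F} (hA : DetProb.IsCoordinatization A M)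
    (hr : M.eRank = r) {b : Fin r → E} (hb : A.submatrix id b = 1) (i : Fin r) (e : E) :
    A i e ≠ 0 ↔ Function.Injective (Function.update b i e) ∧
      M.IsBase (Set.range (Function.update b i e)) := by
  rw [← hA.det_submatrix_ne_zero_iff hr, Matrix.det_submatrix_update hb]

/-- An integer matrix with entries in `{-1, 0, 1}`, equal to the identity on `b`, whose reductions
modulo `2` and modulo `3` coordinatize `M`. -/
structure IsSignedLift (M : Matroid E) (b : Fin r → E) (Z : Matrix (Fin r) E ℤ) : Prop where
  abs_entry_le : ∀ i e, |Z i e| ≤ 1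
  submatrix_eq : Z.submatrix id b = 1
  coord_two : DetProb.IsCoordinatization (Z.map (Int.cast : ℤ → ZMod 2)) M
  coord_three : DetProb.IsCoordinatization (Z.map (Int.cast : ℤ → ZMod 3)) M

theorem submatrix_map_intCast_eq_one {F : Type*} [Field F] {b : Fin r → E}
    {Z : Matrix (Fin r) E ℤ} (h : Z.submatrix id b = 1) :
    (Z.map (Int.cast : ℤ → F)).submatrix id b = 1 := by
  have : (Z.map (Int.cast : ℤ → F)).submatrix id b = (Z.submatrix id b).map Int.cast := rfl
  rw [this, h]
  simp

/-- The pivot matrix for the entry `(i, e)`, when that entry is `±1`. -/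
def pivotMatrix (Z : Matrix (Fin r) E ℤ) (i : Fin r) (e : E) : Matrix (Fin r) (Fin r) ℤ :=
  (1 : Matrix (Fin r) (Fin r) ℤ).updateCol i fun j => if j = i then Z i e else -Z j e * Z i e

theorem det_pivotMatrix (Z : Matrix (Fin r) E ℤ) (i : Fin r) (e : E) :
    (pivotMatrix Z i e).det = Z i e := by
  rw [pivotMatrix, ← Matrix.cramer_apply, Matrix.cramer_one]
  simp

theorem pivotMatrix_mul_apply_self (Z : Matrix (Fin r) E ℤ) (i : Fin r) (e f : E) :
    (pivotMatrix Z i e * Z) i f = Z i e * Z i f := by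
  rw [Matrix.mul_apply, Finset.sum_eq_single i]
  · simp [pivotMatrix]
  · intro k _ hk
    simp [pivotMatrix, hk, Matrix.one_apply_ne hk.symm]
  · simp

theorem pivotMatrix_mul_apply_of_ne (Z : Matrix (Fin r) E ℤ) {i j : Fin r} (hj : j ≠ i) (e f : E) :
    (pivotMatrix Z i e * Z) j f = Z j f - Z j e * Z i e * Z i f := by
  rw [Matrix.mul_apply, Fintype.sum_eq_add j i hj]
  · simp [pivotMatrix, hj]
    ring
  · rintro k ⟨hk, hki⟩
    simp [pivotMatrix, hki, Matrix.one_apply_ne hk.symm]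

theorem Int.mul_self_eq_one_of_abs_le {p : ℤ} (h : |p| ≤ 1) (h0 : p ≠ 0) : p * p = 1 := by
  rw [abs_le] at h
  have : p = 1 ∨ p = -1 := by omega
  rcases this with rfl | rfl <;> rfl

/-- The pivot entry is its own inverse, so pivoting stays over the integers and is invertible modulo
every prime. Only the bound on the entries needs an argument. -/
theorem IsSignedLift.pivot [DecidableEq E] {M : Matroid E} (hr : M.eRank = r) {b : Fin r → E}
    {Z : Matrix (Fin r) E ℤ} (h : IsSignedLift M b Z) {i : Fin r} {e : E} (hie : Z i e ≠ 0) :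
    IsSignedLift M (Function.update b i e) (pivotMatrix Z i e * Z) := by
  have hp := Int.mul_self_eq_one_of_abs_le (h.abs_entry_le i e) hie
  have hsub : (pivotMatrix Z i e * Z).submatrix id (Function.update b i e) = 1 := by
    ext j k
    rw [Matrix.submatrix_apply, id]
    have hcol : ∀ l, Z l (b k) = (1 : Matrix (Fin r) (Fin r) ℤ) l k := fun l => by
      rw [← h.submatrix_eq]; rfl
    by_cases hk : k = i
    · subst hk
      rw [Function.update_self]
      by_cases hj : j = k
      · subst hj
        simp [pivotMatrix_mul_apply_self, hp]
      · rw [pivotMatrix_mul_apply_of_ne Z hj, mul_assoc, hp]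
        simp [hj]
    · rw [Function.update_of_ne hk]
      by_cases hj : j = i
      · subst hj
        rw [pivotMatrix_mul_apply_self, hcol, Matrix.one_apply_ne (Ne.symm hk), mul_zero]
      · rw [pivotMatrix_mul_apply_of_ne Z hj, hcol, hcol i, Matrix.one_apply_ne (Ne.symm hk),
          mul_zero, sub_zero]
  have hcoord : ∀ p : ℕ, [Fact p.Prime] →
      DetProb.IsCoordinatization (Z.map (Int.cast : ℤ → ZMod p)) M →
      DetProb.IsCoordinatization ((pivotMatrix Z i e * Z).map (Int.cast : ℤ → ZMod p)) M := by
    intro p _ hZ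
    have hm : (pivotMatrix Z i e * Z).map (Int.cast : ℤ → ZMod p) =
        (pivotMatrix Z i e).map Int.cast * Z.map Int.cast :=
      Matrix.map_mul (f := Int.castRingHom (ZMod p))
    rw [hm]
    refine hZ.mul_left hr ?_
    have hd : ((pivotMatrix Z i e).map (Int.cast : ℤ → ZMod p)).det = ((Z i e : ℤ) : ZMod p) := by
      rw [← det_pivotMatrix Z i e]
      exact (RingHom.map_det (Int.castRingHom (ZMod p)) _).symm
    rw [hd]
    intro h0
    have := congrArg (Int.cast : ℤ → ZMod p) hp
    push_cast at this
    rw [h0] at this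
    simp at this
  have h2 := hcoord 2 h.coord_two
  have h3 := hcoord 3 h.coord_three
  refine ⟨fun j f => ?_, hsub, h2, h3⟩
  by_cases hj : j = i
  · subst hj
    rw [pivotMatrix_mul_apply_self, abs_mul]
    exact mul_le_one₀ (h.abs_entry_le _ _) (abs_nonneg _) (h.abs_entry_le _ _)
  -- The new entry is at most 2 in absolute value and vanishes mod 2 iff it vanishes mod 3; this
  -- excludes ±2.
  · have hiff := (h2.apply_ne_zero_iff hr (submatrix_map_intCast_eq_one hsub) j f).trans
      (h3.apply_ne_zero_iff hr (submatrix_map_intCast_eq_one hsub) j f).symm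
    have hle : |(pivotMatrix Z i e * Z) j f| ≤ 2 := by
      rw [pivotMatrix_mul_apply_of_ne Z hj]
      refine (abs_sub _ _).trans ?_
      rw [abs_mul, abs_mul]
      have := mul_le_one₀ (mul_le_one₀ (h.abs_entry_le j e) (abs_nonneg _) (h.abs_entry_le i e))
        (abs_nonneg _) (h.abs_entry_le i f)
      linarith [h.abs_entry_le j f]
    simp only [Matrix.map_apply] at hiff
    generalize (pivotMatrix Z i e * Z) j f = n at hiff hle ⊢
    rw [abs_le] at hle ⊢
    by_contra hcon
    have : n = 2 ∨ n = -2 := by omega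
    rcases this with rfl | rfl <;> revert hiff <;> decide

/-- Induction on the number of columns of the minor lying outside `b`. A pivot that brings in such a
column and expels an element not used by `g` lowers this number and changes the minor only by a
sign. -/
theorem IsSignedLift.abs_det_le [DecidableEq E] {M : Matroid E} (hr : M.eRank = r) (n : ℕ) :
    ∀ {b : Fin r → E} {Z : Matrix (Fin r) E ℤ}, IsSignedLift M b Z → ∀ g : Fin r → E,
      Function.Injective g → (Finset.univ.filter fun k => g k ∉ Set.range b).card = n →
      |(Z.submatrix id g).det| ≤ 1 := by
  induction n using Nat.strong_induction_on with
  | _ n ih =>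
    intro b Z h g hg hn
    have hcol : ∀ l k, Z l (b k) = (1 : Matrix (Fin r) (Fin r) ℤ) l k := fun l k => by
      rw [← h.submatrix_eq]; rfl
    by_cases hk : ∃ k, g k ∉ Set.range b
    · obtain ⟨k, hk⟩ := hk
      by_cases hi : ∃ i, b i ∉ Set.range g ∧ Z i (g k) ≠ 0
      · obtain ⟨i, hi, hne⟩ := hi
        have hp := h.pivot hr hne
        have hlt : (Finset.univ.filter fun l => g l ∉ Set.range (Function.update b i (g k))).card <
            n := by
          rw [← hn]
          refine Finset.card_lt_card (Finset.ssubset_iff_subset_ne.2 ⟨fun l => ?_, fun heq => ?_⟩)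
          · simp only [Finset.mem_filter, Finset.mem_univ, true_and]
            rintro hl ⟨j, hj⟩
            refine hl ⟨j, ?_⟩
            rw [Function.update_of_ne, hj]
            rintro rfl
            exact hi ⟨l, hj.symm⟩
          · have : k ∈ Finset.univ.filter fun l => g l ∉ Set.range b := by simpa using hk
            rw [← heq] at this
            simp only [Finset.mem_filter, Finset.mem_univ, true_and] at this
            exact this ⟨i, by simp⟩
        have := ih _ hlt hp g hg rfl
        have hmul : (pivotMatrix Z i (g k) * Z).submatrix id g =
            pivotMatrix Z i (g k) * Z.submatrix id g := rfl
        rw [hmul, Matrix.det_mul, det_pivotMatrix, abs_mul] at this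
        have h1 : 1 ≤ |Z i (g k)| := Int.one_le_abs hne
        nlinarith [abs_nonneg (Z.submatrix id g).det]
      -- With no admissible pivot, column `g k` is supported on rows `i` for which the unit column
      -- `b i` also occurs in the minor, so the columns are dependent.
      · have hdet : (Z.submatrix id g).det = 0 := by
          by_contra hdet
          have hli := Matrix.linearIndependent_cols_of_det_ne_zero hdet
          refine hli.notMem_span_image (s := {k}ᶜ) (x := k) (by simp) ?_
          have hsum : (Z.submatrix id g).col k =
              ∑ i, Z i (g k) • (Pi.single i 1 : Fin r → ℤ) := by
            ext l
            simp [Pi.single_apply]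
          rw [hsum]
          refine Submodule.sum_mem _ fun i _ => ?_
          by_cases h0 : Z i (g k) = 0
          · simp [h0]
          · refine Submodule.smul_mem _ _ (Submodule.subset_span ?_)
            obtain ⟨j, hj⟩ : b i ∈ Set.range g := by
              by_contra hcon
              exact hi ⟨i, hcon, h0⟩
            refine ⟨j, ?_, ?_⟩
            · rintro rfl
              exact hk ⟨i, hj.symm⟩
            · ext l
              simp [hj, hcol, Matrix.one_apply, Pi.single_apply]
        simp [hdet]
    -- All columns come from `b`, so the minor is that of a permutation matrix.
    · simp only [not_exists, not_not] at hk
      choose σ hσ using hk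
      have hinj : Function.Injective σ := fun x y hxy => hg (by rw [← hσ, ← hσ, hxy])
      let τ : Equiv.Perm (Fin r) := Equiv.ofBijective σ (Finite.injective_iff_bijective.1 hinj)
      have : Z.submatrix id g = (1 : Matrix (Fin r) (Fin r) ℤ).submatrix id τ := by
        ext l k
        rw [Matrix.submatrix_apply, ← hσ, hcol]
        rfl
      rw [this, Matrix.det_permute']
      simp

/-- The homomorphisms `f` and `g` allow universe-lifted copies of the prime fields, as needed when
regularity quantifies over fields in an arbitrary universe. -/
theorem DetProb.exists_isSignedLift [DecidableEq E] {M : Matroid E} (hr : M.eRank = r)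
    (b : Fin r ↪ E) (hb : M.IsBase (Set.range b)) {F K : Type*} [Field F] [Field K]
    (h2 : DetProb.IsRepresentableOver F M) (h3 : DetProb.IsRepresentableOver K M)
    (f : F →+* ZMod 2) (g : K →+* ZMod 3) :
    ∃ Z : Matrix (Fin r) E ℤ, IsSignedLift M b Z := by
  obtain ⟨A, hA, hAb⟩ := h2.exists_standard b hb
  obtain ⟨B, hB, hBb⟩ := h3.exists_standard b hb
  have hA' := hA.map hr f
  have hB' := hB.map hr g
  have hAb' : (A.map f).submatrix id b = 1 := by
    rw [Matrix.submatrix_map, hAb]; simp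
  have hBb' : (B.map g).submatrix id b = 1 := by
    rw [Matrix.submatrix_map, hBb]; simp
  generalize A.map f = A at hA' hAb'
  generalize B.map g = B at hB' hBb'
  let s : ZMod 3 → ℤ := fun x => if x = 0 then 0 else if x = 1 then 1 else -1
  have hZ3 : (B.map s).map (Int.cast : ℤ → ZMod 3) = B := by
    ext i e
    have : ∀ x : ZMod 3, ((s x : ℤ) : ZMod 3) = x := by decide
    exact this _
  -- A matrix over `ZMod 2` is determined by its support, which it shares with `B`.
  have hZ2 : (B.map s).map (Int.cast : ℤ → ZMod 2) = A := by
    ext i e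
    have hiff := (hA'.apply_ne_zero_iff hr hAb' i e).trans (hB'.apply_ne_zero_iff hr hBb' i e).symm
    have : ∀ (x : ZMod 3) (y : ZMod 2), (y ≠ 0 ↔ x ≠ 0) → ((s x : ℤ) : ZMod 2) = y := by decide
    exact this _ _ hiff
  refine ⟨B.map s, fun i e => ?_, ?_, by rwa [hZ2], by rwa [hZ3]⟩
  · have : ∀ x : ZMod 3, |s x| ≤ 1 := by decide
    exact this _
  · change (B.submatrix id b).map s = 1
    rw [hBb']
    exact Matrix.map_one s rfl rfl

/-- A regular matroid has a unimodular coordinatization over the integers. -/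
theorem DetProb.IsRegular.exists_int_matrix {E : Type u} [DecidableEq E] {M : Matroid E}
    (h : DetProb.IsRegular.{u, v} M) (hr : M.eRank = r) :
    ∃ Z : Matrix (Fin r) E ℤ, ∀ b : Fin r ↪ E,
      |(Z.submatrix id b).det| ≤ 1 ∧
        (M.IsBase (Set.range b) ↔ (Z.submatrix id b).det ≠ 0) := by
  obtain ⟨B, hB⟩ := M.exists_isBase
  obtain ⟨b, rfl⟩ := hB.exists_embedding hr
  obtain ⟨Z, hZ⟩ := DetProb.exists_isSignedLift hr b hB (h (ULift (ZMod 2))) (h (ULift (ZMod 3)))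
    (ULift.ringEquiv : ULift (ZMod 2) ≃+* ZMod 2).toRingHom
    (ULift.ringEquiv : ULift (ZMod 3) ≃+* ZMod 3).toRingHom
  refine ⟨Z, fun c => ?_⟩
  have hle := hZ.abs_det_le hr _ c c.injective rfl
  refine ⟨hle, ?_⟩
  rw [hZ.coord_two.isBase_range_iff hr]
  have : ((Z.map (Int.cast : ℤ → ZMod 2)).submatrix id c).det =
      (((Z.submatrix id c).det : ℤ) : ZMod 2) :=
    (RingHom.map_det (Int.castRingHom (ZMod 2)) (Z.submatrix id c)).symm
  rw [this]
  generalize (Z.submatrix id c).det = n at hle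
  rw [abs_le] at hle
  have : n = 0 ∨ n = 1 ∨ n = -1 := by omega
  rcases this with rfl | rfl | rfl <;> decide

/-- A real coordinatization whose base minors have absolute value `1` makes a matroid regular. -/
theorem DetProb.isRegular_of_abs_det_eq_one {E : Type u} [DecidableEq E] {M : Matroid E}
    (hr : M.eRank = r) {A : Matrix (Fin r) E ℝ} (hA : DetProb.IsCoordinatization A M)
    (h : ∀ b : Fin r ↪ E, M.IsBase (Set.range b) → ‖(A.submatrix id b).det‖ = 1) :
    DetProb.IsRegular.{u, v} M := by
  intro F _
  obtain ⟨B, hB⟩ := M.exists_isBase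
  obtain ⟨b, rfl⟩ := hB.exists_embedding hr
  have hb0 := (hA.isBase_range_iff hr b).1 hB
  set U := (A.submatrix id b)⁻¹ with hU
  have hUdet : ‖U.det‖ = 1 := by
    rw [hU, Matrix.det_nonsing_inv, Ring.inverse_eq_inv', norm_inv, h b hB, inv_one]
  have hUb : (U * A).submatrix id b = 1 :=
    Matrix.nonsing_inv_mul _ (isUnit_iff_ne_zero.2 hb0)
  have hdet : ∀ g : Fin r → E, ∃ n : ℤ, (n = 0 ∨ n = 1 ∨ n = -1) ∧
      ((U * A).submatrix id g).det = n := by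
    intro g
    have hmul : (U * A).submatrix id g = U * A.submatrix id g := rfl
    by_cases hg : (A.submatrix id g).det = 0
    · exact ⟨0, by simp, by rw [hmul, Matrix.det_mul, hg]; simp⟩
    · obtain ⟨hi, hgb⟩ := (hA.det_submatrix_ne_zero_iff hr g).1 hg
      have : ‖((U * A).submatrix id g).det‖ = 1 := by
        rw [hmul, Matrix.det_mul, norm_mul, hUdet, one_mul]
        exact h ⟨g, hi⟩ hgb
      rw [Real.norm_eq_abs] at this
      rcases eq_or_eq_neg_of_abs_eq this with h1 | h1
      · exact ⟨1, by simp, by simp [h1]⟩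
      · exact ⟨-1, by simp, by simp [h1]⟩
  -- Each entry is itself a minor, obtained by exchanging one element of `b`.
  have hent : ∀ i e, ∃ n : ℤ, (U * A) i e = n := fun i e => by
    obtain ⟨n, -, hn⟩ := hdet (Function.update b i e)
    exact ⟨n, by rw [← hn, Matrix.det_submatrix_update hUb]⟩
  choose Z hZ using hent
  have hZA : U * A = (Matrix.of Z).map (Int.cast : ℤ → ℝ) := by
    ext i e
    simp [hZ]
  have hUA : DetProb.IsCoordinatization (U * A) M := hA.mul_left hr fun h0 => by
    simp [h0] at hUdet
  refine ⟨r, (Matrix.of Z).map Int.cast,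
    DetProb.isCoordinatization_of_isBase_range_iff hr fun c => ?_⟩
  obtain ⟨n, hn, hdn⟩ := hdet c
  rw [hUA.isBase_range_iff hr, hdn]
  have h1 : ∀ (K : Type _) [Field K], (((Matrix.of Z).map (Int.cast : ℤ → K)).submatrix id c).det =
      ((((Matrix.of Z).submatrix id c).det : ℤ) : K) := fun K _ =>
    (RingHom.map_det (Int.castRingHom K) ((Matrix.of Z).submatrix id c)).symm
  have h2 : ((Matrix.of Z).submatrix id c).det = n := by
    have : ((U * A).submatrix id c).det = ((((Matrix.of Z).submatrix id c).det : ℤ) : ℝ) := by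
      rw [hZA]
      exact (RingHom.map_det (Int.castRingHom ℝ) ((Matrix.of Z).submatrix id c)).symm
    rw [hdn] at this
    exact_mod_cast this.symm
  rw [h1 F, h2]
  -- The values 0, 1, -1 vanish in `F` exactly when they vanish in ℝ, whatever the characteristic.
  rcases hn with rfl | rfl | rfl <;> simp

end Regular

/-! ### The Cauchy–Binet formula -/

section CauchyBinet

variable {E : Type*} {r : ℕ} {R : Type*} [CommRing R]

/-- The enumeration of an `r`-element finite set used in the weights of `P^H`. -/
noncomputable def enum (B : Finset E) (h : B.card = r) (j : Fin r) : E :=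
  ((B.equivFinOfCardEq h).symm j : E)

theorem enum_injective (B : Finset E) (h : B.card = r) : Function.Injective (enum B h) :=
  fun _ _ hij => (B.equivFinOfCardEq h).symm.injective (Subtype.ext hij)

theorem range_enum (B : Finset E) (h : B.card = r) : Set.range (enum B h) = B := by
  ext x
  constructor
  · rintro ⟨j, rfl⟩
    exact ((B.equivFinOfCardEq h).symm j).2
  · intro hx
    exact ⟨B.equivFinOfCardEq h ⟨x, hx⟩, by simp [enum]⟩

theorem exists_perm_comp_eq {f g : Fin r → E} (hf : Function.Injective f)
    (hfg : Set.range f ⊆ Set.range g) : ∃ σ : Equiv.Perm (Fin r), g ∘ σ = f := by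
  choose σ hσ using fun i => hfg ⟨i, rfl⟩
  have hinj : Function.Injective σ := fun x y hxy => hf (by rw [← hσ, ← hσ, hxy])
  exact ⟨Equiv.ofBijective σ (Finite.injective_iff_bijective.1 hinj), funext hσ⟩

variable [Fintype E] [DecidableEq E]

/-- Expansion of the determinant of a product over all maps of indices. -/
theorem det_mul_eq_sum_functions (V : Matrix (Fin r) E R) (W : Matrix E (Fin r) R) :
    (V * W).det = ∑ f : Fin r → E, (∏ i, W (f i) i) * (V.submatrix id f).det := by
  have h : (V * W).transpose = fun i => ∑ e, W e i • V.col e := by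
    ext i j
    simp [Matrix.mul_apply, mul_comm]
  rw [← Matrix.det_transpose, h]
  have := (Matrix.detRowAlternating (n := Fin r) (R := R)).toMultilinearMap.map_sum
    (fun i e => W e i • V.col e)
  refine this.trans (Finset.sum_congr rfl fun f _ => ?_)
  rw [MultilinearMap.map_smul_univ, ← Matrix.det_transpose (V.submatrix id f)]
  rfl

/-- The Cauchy–Binet formula. -/
theorem det_mul_eq_sum_minors (V : Matrix (Fin r) E R) (W : Matrix E (Fin r) R) :
    (V * W).det = ∑ B : Finset E, if h : B.card = r then
      (V.submatrix id (enum B h)).det * (W.submatrix (enum B h) id).det else 0 := by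
  -- Maps are grouped by image. Only injective ones contribute, and those with image `B` are the
  -- enumeration of `B` composed with a permutation.
  rw [det_mul_eq_sum_functions,
    ← Finset.sum_fiberwise Finset.univ (fun f : Fin r → E => Finset.univ.image f)]
  refine Finset.sum_congr rfl fun B _ => ?_
  have hzero : ∀ f : Fin r → E, ¬ Function.Injective f → (V.submatrix id f).det = 0 := by
    intro f hf
    simp only [Function.Injective, not_forall] at hf
    obtain ⟨i, j, hij, hne⟩ := hf
    exact Matrix.det_zero_of_column_eq hne fun k => by simp [hij]
  split_ifs with h
  · have h1 : (W.submatrix (enum B h) id).det =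
        ∑ σ : Equiv.Perm (Fin r), (Equiv.Perm.sign σ : ℤ) * ∏ i, W (enum B h (σ i)) i := by
      rw [Matrix.det_apply']
      rfl
    rw [h1, Finset.mul_sum]
    symm
    refine Finset.sum_bij_ne_zero (fun σ _ _ => enum B h ∘ σ) ?_ ?_ ?_ ?_
    · intro σ _ _
      simp only [Finset.mem_filter, Finset.mem_univ, true_and]
      rw [← Finset.coe_inj, Finset.coe_image, Finset.coe_univ, Set.image_univ, Set.range_comp,
        σ.surjective.range_eq, Set.image_univ, range_enum]
    · intro σ _ _ τ _ _ hστ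
      ext i
      exact congrArg Fin.val (enum_injective B h (congrFun hστ i))
    · intro f hf hne
      simp only [Finset.mem_filter, Finset.mem_univ, true_and] at hf
      have hfi : Function.Injective f := by
        by_contra hcon
        exact hne (by rw [hzero f hcon, mul_zero])
      obtain ⟨σ, hσ⟩ := exists_perm_comp_eq hfi (g := enum B h) (by
        rw [range_enum, ← hf]; simp)
      refine ⟨σ, Finset.mem_univ _, ?_, hσ⟩
      intro h0
      apply hne
      subst hσ
      have : V.submatrix id (enum B h ∘ σ) = (V.submatrix id (enum B h)).submatrix id σ := rfl
      rw [this, Matrix.det_permute', ← h0]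
      simp only [Function.comp_apply]
      ring
    · intro σ _ _
      have : V.submatrix id (enum B h ∘ σ) = (V.submatrix id (enum B h)).submatrix id σ := rfl
      rw [this, Matrix.det_permute']
      simp only [Function.comp_apply]
      ring
  · refine Finset.sum_eq_zero fun f hf => ?_
    simp only [Finset.mem_filter, Finset.mem_univ, true_and] at hf
    rw [hzero f, mul_zero]
    intro hfi
    apply h
    rw [← hf, Finset.card_image_of_injective _ hfi]
    simp

theorem norm_det_submatrix_eq_of_range_eq {𝕜 : Type*} [RCLike 𝕜] (V : Matrix (Fin r) E 𝕜)
    {f g : Fin r → E} (hf : Function.Injective f) (h : Set.range f = Set.range g) :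
    ‖(V.submatrix id f).det‖ = ‖(V.submatrix id g).det‖ := by
  obtain ⟨σ, rfl⟩ := exists_perm_comp_eq hf h.subset
  have : V.submatrix id (g ∘ σ) = (V.submatrix id g).submatrix id σ := rfl
  rw [this, Matrix.det_permute', norm_mul]
  rcases Int.units_eq_one_or (Equiv.Perm.sign σ) with h | h <;> simp [h]

end CauchyBinet

/-! ### Determinantal measures and unimodular coordinatizations -/

section DeterminantalMeasure

variable {𝕜 : Type*} [RCLike 𝕜] {E : Type*} [Fintype E] [DecidableEq E]

namespace DetProb

/-- The matrix of inner products of an orthonormal basis of `H` with the standard basis. -/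
noncomputable def frameMatrix (H : Submodule 𝕜 (EuclideanSpace 𝕜 E)) :
    Matrix (Fin (Module.finrank 𝕜 H)) E 𝕜 :=
  Matrix.of fun i e => ⟪(stdOrthonormalBasis 𝕜 H i : EuclideanSpace 𝕜 E), unitVec 𝕜 e⟫_𝕜

variable (H : Submodule 𝕜 (EuclideanSpace 𝕜 E))

theorem frameMatrix_apply (i : Fin (Module.finrank 𝕜 H)) (e : E) :
    frameMatrix H i e = star ((stdOrthonormalBasis 𝕜 H i : EuclideanSpace 𝕜 E) e) := by
  simp [frameMatrix, unitVec, EuclideanSpace.inner_single_right]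

theorem frameMatrix_mul_conjTranspose : frameMatrix H * (frameMatrix H).conjTranspose = 1 := by
  ext i j
  have h := orthonormal_iff_ite.1 (stdOrthonormalBasis 𝕜 H).orthonormal i j
  rw [Matrix.one_apply, ← h, Submodule.coe_inner, PiLp.inner_apply, Matrix.mul_apply]
  refine Finset.sum_congr rfl fun e _ => ?_
  simp [frameMatrix_apply, mul_comm]

theorem weight_eq (B : Finset E) : weight H B = if h : B.card = Module.finrank 𝕜 H then
    ‖((frameMatrix H).submatrix id (enum B h)).det‖ ^ 2 else 0 := rfl

theorem weight_nonneg (B : Finset E) : 0 ≤ weight H B := by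
  rw [weight_eq]
  split_ifs <;> positivity

theorem weight_eq_of_range_eq {B : Finset E} (b : Fin (Module.finrank 𝕜 H) ↪ E)
    (hb : Set.range b = B) : weight H B = ‖((frameMatrix H).submatrix id b).det‖ ^ 2 := by
  have hc : B.card = Module.finrank 𝕜 H := by
    have := encard_range_embedding b
    rw [hb, Set.encard_coe_eq_coe_finsetCard] at this
    exact_mod_cast this
  rw [weight_eq, dif_pos hc, norm_det_submatrix_eq_of_range_eq _ b.injective
    (hb.trans (range_enum B hc).symm)]

/-- Cauchy–Binet applied to the product of the frame matrix with its conjugate transpose, which is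
the identity. -/
theorem sum_weight : ∑ B : Finset E, weight H B = 1 := by
  have h := det_mul_eq_sum_minors (frameMatrix H) (frameMatrix H).conjTranspose
  rw [frameMatrix_mul_conjTranspose, Matrix.det_one] at h
  have h2 : ((1 : ℝ) : 𝕜) = ((∑ B : Finset E, weight H B : ℝ) : 𝕜) := by
    push_cast
    rw [h]
    refine Finset.sum_congr rfl fun B _ => ?_
    rw [weight_eq]
    split_ifs with hB
    · have : (frameMatrix H).conjTranspose.submatrix (enum B hB) id =
          ((frameMatrix H).submatrix id (enum B hB)).conjTranspose := rfl
      rw [this, Matrix.det_conjTranspose]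
      push_cast
      exact RCLike.mul_conj _
    · simp
  exact_mod_cast h2.symm

theorem detMeasure_singleton (B : Finset E) :
    detMeasure H {(B : Set E)} = ENNReal.ofReal (weight H B) := by
  rw [detMeasure, Measure.finsetSum_apply, Finset.sum_eq_single B]
  · simp
  · intro C _ hC
    simp [hC]
  · simp

theorem detMeasure_univ : detMeasure H Set.univ = 1 := by
  rw [detMeasure, Measure.finsetSum_apply]
  simp only [Measure.smul_apply, measure_univ, smul_eq_mul, mul_one]
  rw [← ENNReal.ofReal_sum_of_nonneg fun B _ => weight_nonneg H B, sum_weight, ENNReal.ofReal_one]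

theorem uniformOn_eq_smul {Ω : Type*} [MeasurableSpace Ω] (S : Set Ω) :
    uniformOn S = (Measure.count S)⁻¹ • Measure.count.restrict S := rfl

theorem detMeasure_eq_uniformOn_iff {S : Set (Set E)} :
    detMeasure H = uniformOn S ↔
      (∀ B : Finset E, (B : Set E) ∉ S → weight H B = 0) ∧
      ∀ B C : Finset E, (B : Set E) ∈ S → (C : Set E) ∈ S → weight H B = weight H C := by
  have hsing : ∀ (B : Finset E) (c : ENNReal), (c • Measure.count.restrict S) {(B : Set E)} =
      open Classical in if (B : Set E) ∈ S then c else 0 := by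
    intro B c
    rw [Measure.smul_apply, Measure.restrict_apply (measurableSet_singleton _)]
    split_ifs with h
    · rw [Set.inter_eq_left.2 (Set.singleton_subset_iff.2 h)]
      simp
    · rw [Set.singleton_inter_eq_empty.2 h]
      simp
  constructor
  · intro h
    have hw : ∀ B : Finset E, ENNReal.ofReal (weight H B) =
        open Classical in if (B : Set E) ∈ S then (Measure.count S)⁻¹ else 0 := fun B => by
      rw [← detMeasure_singleton, h, uniformOn_eq_smul, hsing]
    refine ⟨fun B hB => ?_, fun B C hB hC => ?_⟩
    · have := hw B
      rw [if_neg hB, ENNReal.ofReal_eq_zero] at this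
      exact le_antisymm this (weight_nonneg H B)
    · rw [← ENNReal.ofReal_eq_ofReal_iff (weight_nonneg H B) (weight_nonneg H C), hw, hw,
        if_pos hB, if_pos hC]
  · rintro ⟨h0, hc⟩
    obtain ⟨c, hc'⟩ : ∃ c : ℝ, ∀ B : Finset E, (B : Set E) ∈ S → weight H B = c := by
      by_cases hS : ∃ B : Finset E, (B : Set E) ∈ S
      · obtain ⟨B, hB⟩ := hS
        exact ⟨weight H B, fun C hC => hc C B hC hB⟩
      · exact ⟨0, fun B hB => (hS ⟨B, hB⟩).elim⟩
    have hdet : detMeasure H = ENNReal.ofReal c • Measure.count.restrict S := by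
      refine Measure.ext_of_singleton fun X => ?_
      obtain ⟨B, rfl⟩ := (Set.toFinite X).exists_finset_coe
      rw [detMeasure_singleton, hsing]
      split_ifs with hB
      · rw [hc' B hB]
      · rw [h0 B hB, ENNReal.ofReal_zero]
    -- Total mass 1 forces the common weight to be the inverse of the number of elements of `S`.
    have huniv := detMeasure_univ H
    rw [hdet, Measure.smul_apply, Measure.restrict_apply_univ, smul_eq_mul] at huniv
    rw [hdet, uniformOn_eq_smul, ENNReal.eq_inv_of_mul_eq_one_left huniv]

theorem starProjection_unitVec (e : E) : H.starProjection (unitVec 𝕜 e) =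
    ((stdOrthonormalBasis 𝕜 H).repr.symm (WithLp.toLp 2 ((frameMatrix H).col e)) : H) := by
  rw [Submodule.starProjection_apply,
    (stdOrthonormalBasis 𝕜 H).orthogonalProjectionOnto_apply_eq_sum,
    ← (stdOrthonormalBasis 𝕜 H).sum_repr_symm]
  rfl

/-- The columns of the frame matrix are the coordinates of the projections, and passing from
coordinates to vectors is injective. -/
theorem linearIndepOn_starProjection_iff (S : Set E) :
    LinearIndepOn 𝕜 (fun e => H.starProjection (unitVec 𝕜 e)) S ↔
      LinearIndepOn 𝕜 (frameMatrix H).col S := by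
  let φ : (Fin (Module.finrank 𝕜 H) → 𝕜) →ₗ[𝕜] EuclideanSpace 𝕜 E :=
    H.subtype ∘ₗ ((WithLp.linearEquiv 2 𝕜 _).symm.trans
      (stdOrthonormalBasis 𝕜 H).repr.symm.toLinearEquiv).toLinearMap
  have hφ : LinearMap.ker φ = ⊥ := by
    rw [LinearMap.ker_eq_bot]
    exact H.subtype_injective.comp (LinearEquiv.injective _)
  have h : (fun e => H.starProjection (unitVec 𝕜 e)) = φ ∘ (frameMatrix H).col :=
    funext fun e => starProjection_unitVec H e
  unfold LinearIndepOn
  rw [h]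
  exact LinearMap.linearIndependent_iff (v := fun x : S => (frameMatrix H).col x) φ hφ

theorem span_starProjection_eq {B : Finset E} (hB : B.card = Module.finrank 𝕜 H)
    (hli : LinearIndepOn 𝕜 (fun e => H.starProjection (unitVec 𝕜 e)) (B : Set E)) :
    Submodule.span 𝕜 ((fun e => H.starProjection (unitVec 𝕜 e)) '' (B : Set E)) = H := by
  refine Submodule.eq_of_le_of_finrank_eq ?_ ?_
  · rw [Submodule.span_le]
    rintro _ ⟨e, -, rfl⟩
    exact Submodule.starProjection_apply_mem _ _
  · rw [Set.image_eq_range, finrank_span_eq_card hli]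
    simpa using hB

/-- `Represents` does not prescribe the dimension of `H`; it follows from any one base, whose
projections form a basis of `H`. -/
theorem represents_iff (M : Matroid E) :
    Represents H M ↔ M.eRank = Module.finrank 𝕜 H ∧ IsCoordinatization (frameMatrix H) M := by
  constructor
  · intro h
    obtain ⟨B, hB⟩ := M.exists_isBase
    obtain ⟨B, rfl⟩ := (Set.toFinite B).exists_finset_coe
    have hBr := hB.encard_eq_eRank
    rw [Set.encard_coe_eq_coe_finsetCard] at hBr
    obtain ⟨hli, hsp⟩ := (h B hBr).1 hB
    have hcard : Module.finrank 𝕜 H = B.card := by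
      rw [← congrArg (fun K : Submodule 𝕜 (EuclideanSpace 𝕜 E) => Module.finrank 𝕜 K) hsp,
        Set.image_eq_range]
      exact (finrank_span_eq_card hli).trans (by simp)
    have hr : M.eRank = Module.finrank 𝕜 H := by rw [hcard, hBr]
    refine ⟨hr, isCoordinatization_of_isBase_range_iff hr fun b => ?_⟩
    obtain ⟨C, hC⟩ := (Set.finite_range b).exists_finset_coe
    have hCc : C.card = Module.finrank 𝕜 H := by
      have := encard_range_embedding b
      rw [← hC, Set.encard_coe_eq_coe_finsetCard] at this
      exact_mod_cast this
    rw [← linearIndepOn_col_range_iff, ← hC, h C (by rw [hr, hCc]),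
      ← linearIndepOn_starProjection_iff]
    exact ⟨fun h => h.1, fun h => ⟨h, span_starProjection_eq H hCc h⟩⟩
  · rintro ⟨hr, hA⟩ B hB
    rw [hr, Nat.cast_inj] at hB
    obtain ⟨b, hb⟩ := exists_embedding_range_eq (E := E) (B := B) (r := Module.finrank 𝕜 H)
      (by rw [Set.encard_coe_eq_coe_finsetCard, hB])
    rw [← hb, Matroid.isBase_range_iff_indep hr, hA, hb, linearIndepOn_starProjection_iff]
    exact ⟨fun h => ⟨h, span_starProjection_eq H hB ((linearIndepOn_starProjection_iff H _).2 h)⟩,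
      fun h => h.1⟩

/-- A matroid has a coordinatization over `𝕜` all of whose base minors have absolute value `1`. -/
def IsUnimodularOver (𝕜 : Type*) [RCLike 𝕜] {E : Type*} (M : Matroid E) : Prop :=
  ∃ (r : ℕ) (A : Matrix (Fin r) E 𝕜), M.eRank = r ∧ IsCoordinatization A M ∧
    ∀ b : Fin r ↪ E, M.IsBase (Set.range b) → ‖(A.submatrix id b).det‖ = 1

variable {H} in
-- Equal weights mean base minors of equal modulus; multiplying by the inverse of one base submatrix
-- divides them all by that modulus.
theorem Represents.isUnimodularOver {M : Matroid E} (h : Represents H M)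
    (hu : detMeasure H = uniformOn {B : Set E | M.IsBase B}) : IsUnimodularOver 𝕜 M := by
  obtain ⟨hr, hA⟩ := (represents_iff H M).1 h
  obtain ⟨B, hB⟩ := M.exists_isBase
  obtain ⟨b, rfl⟩ := hB.exists_embedding hr
  have hb0 := (hA.isBase_range_iff hr b).1 hB
  have hdet : (((frameMatrix H).submatrix id b)⁻¹).det = ((frameMatrix H).submatrix id b).det⁻¹ := by
    rw [Matrix.det_nonsing_inv, Ring.inverse_eq_inv']
  refine ⟨_, ((frameMatrix H).submatrix id b)⁻¹ * frameMatrix H, hr,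
    hA.mul_left hr (by rw [hdet]; exact inv_ne_zero hb0), fun c hc => ?_⟩
  have hmul : (((frameMatrix H).submatrix id b)⁻¹ * frameMatrix H).submatrix id c =
      ((frameMatrix H).submatrix id b)⁻¹ * (frameMatrix H).submatrix id c := rfl
  have hw := ((detMeasure_eq_uniformOn_iff H).1 hu).2 (Finset.univ.map b) (Finset.univ.map c)
    (by simpa using hB) (by simpa using hc)
  rw [weight_eq_of_range_eq H b (by simp), weight_eq_of_range_eq H c (by simp),
    sq_eq_sq₀ (norm_nonneg _) (norm_nonneg _)] at hw
  rw [hmul, Matrix.det_mul, norm_mul, hdet, norm_inv, hw]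
  exact inv_mul_cancel₀ (by rw [← hw]; exact norm_ne_zero_iff.2 hb0)

/-- The subspace spanned by the conjugates of the rows of a matrix. -/
def rowSubspace {r : ℕ} (A : Matrix (Fin r) E 𝕜) : Submodule 𝕜 (EuclideanSpace 𝕜 E) :=
  Submodule.span 𝕜 (Set.range fun i => WithLp.toLp 2 fun e => star (A i e))

theorem finrank_rowSubspace {r : ℕ} {A : Matrix (Fin r) E 𝕜} {b : Fin r → E}
    (hb : (A.submatrix id b).det ≠ 0) : Module.finrank 𝕜 (rowSubspace A) = r := by
  have hli : LinearIndependent 𝕜 fun i =>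
      (WithLp.toLp 2 fun e => star (A i e) : EuclideanSpace 𝕜 E) := by
    have hdet : ((A.submatrix id b).map star).det ≠ 0 := by
      have : (A.submatrix id b).map star = (A.submatrix id b).conjTranspose.transpose := rfl
      rw [this, Matrix.det_transpose, Matrix.det_conjTranspose]
      exact star_ne_zero.2 hb
    let φ : EuclideanSpace 𝕜 E →ₗ[𝕜] (Fin r → 𝕜) :=
      LinearMap.funLeft 𝕜 𝕜 b ∘ₗ (WithLp.linearEquiv 2 𝕜 (E → 𝕜)).toLinearMap
    exact LinearIndependent.of_comp φ (Matrix.linearIndependent_rows_of_det_ne_zero hdet)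
  rw [rowSubspace, finrank_span_eq_card hli, Fintype.card_fin]

/-- The conjugation in `rowSubspace` cancels the one caused by conjugate-linearity of the inner
product in its first slot, so `A` itself appears. -/
theorem exists_frameMatrix_rowSubspace_eq {r : ℕ} (A : Matrix (Fin r) E 𝕜) :
    ∃ T : Matrix (Fin (Module.finrank 𝕜 (rowSubspace A))) (Fin r) 𝕜,
      frameMatrix (rowSubspace A) = T * A := by
  have h : ∀ i, ∃ c : Fin r → 𝕜, ∑ j, c j • (WithLp.toLp 2 fun e => star (A j e)) =
      (stdOrthonormalBasis 𝕜 (rowSubspace A) i : EuclideanSpace 𝕜 E) := fun i =>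
    (Submodule.mem_span_range_iff_exists_fun 𝕜).1 (stdOrthonormalBasis 𝕜 (rowSubspace A) i).2
  choose c hc using h
  refine ⟨Matrix.of fun i j => star (c i j), ?_⟩
  ext i e
  rw [frameMatrix_apply, ← hc]
  simp [Matrix.mul_apply]

theorem IsUnimodularOver.exists_represents {M : Matroid E} (h : IsUnimodularOver 𝕜 M) :
    ∃ H : Submodule 𝕜 (EuclideanSpace 𝕜 E),
      Represents H M ∧ detMeasure H = uniformOn {B : Set E | M.IsBase B} := by
  obtain ⟨r, A, hr, hA, hu⟩ := h
  obtain ⟨B, hB⟩ := M.exists_isBase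
  obtain ⟨b, rfl⟩ := hB.exists_embedding hr
  have hd := finrank_rowSubspace ((hA.isBase_range_iff hr b).1 hB)
  obtain ⟨T, hT⟩ := exists_frameMatrix_rowSubspace_eq A
  refine ⟨rowSubspace A, ?_⟩
  -- Abstracting `H` lets `r` be replaced by its dimension, so that `T` becomes square.
  generalize rowSubspace A = H at hd T hT
  subst hd
  -- The frame matrix times its conjugate transpose is 1, so `T` has a right inverse.
  have hT0 : T.det ≠ 0 := by
    have := frameMatrix_mul_conjTranspose H
    intro h0
    have h1 := congrArg Matrix.det this
    nth_rewrite 1 [hT] at h1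
    rw [Matrix.mul_assoc, Matrix.det_mul, h0, zero_mul, Matrix.det_one] at h1
    exact zero_ne_one h1
  have hco : IsCoordinatization (frameMatrix H) M := by
    rw [hT]
    exact hA.mul_left hr hT0
  refine ⟨(represents_iff H M).2 ⟨hr, hco⟩, (detMeasure_eq_uniformOn_iff H).2 ⟨?_, ?_⟩⟩
  · intro B hB
    by_cases hc : B.card = Module.finrank 𝕜 H
    · have hb := range_enum B hc
      rw [weight_eq_of_range_eq H ⟨enum B hc, enum_injective B hc⟩ hb]
      have := (hco.isBase_range_iff hr ⟨enum B hc, enum_injective B hc⟩).not.1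
        (by rwa [Function.Embedding.coeFn_mk, hb])
      rw [not_not] at this
      rw [this]
      simp
    · rw [weight_eq, dif_neg hc]
  · have hw : ∀ B : Finset E, M.IsBase (B : Set E) → weight H B = ‖T.det‖ ^ 2 := by
      intro B hB
      obtain ⟨b, hb⟩ := hB.exists_embedding hr
      have hmul : (T * A).submatrix id b = T * A.submatrix id b := rfl
      rw [weight_eq_of_range_eq H b hb, hT, hmul, Matrix.det_mul, norm_mul, hu b (by rwa [hb]),
        mul_one]
    intro B C hB hC
    rw [hw B hB, hw C hC]

theorem exists_represents_iff_isUnimodularOver (M : Matroid E) :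
    (∃ H : Submodule 𝕜 (EuclideanSpace 𝕜 E),
      Represents H M ∧ detMeasure H = uniformOn {B : Set E | M.IsBase B}) ↔
      IsUnimodularOver 𝕜 M :=
  ⟨fun ⟨_, h, hu⟩ => h.isUnimodularOver hu, fun h => h.exists_represents⟩

end DetProb

end DeterminantalMeasure

/-! ### Real unimodularity versus regularity, and the conclusion -/

theorem DetProb.isUnimodularOver_real_iff_isRegular {E : Type u} [Fintype E] [DecidableEq E]
    (M : Matroid E) : DetProb.IsUnimodularOver ℝ M ↔ DetProb.IsRegular.{u, v} M := by
  constructor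
  · rintro ⟨r, A, hr, hA, h⟩
    exact DetProb.isRegular_of_abs_det_eq_one hr hA h
  · intro h
    obtain ⟨B, hB⟩ := M.exists_isBase
    obtain ⟨r, hr⟩ : ∃ r : ℕ, M.eRank = r := by
      rw [← hB.encard_eq_eRank]
      exact ⟨_, (Set.toFinite B).encard_eq_coe⟩
    obtain ⟨Z, hZ⟩ := h.exists_int_matrix hr
    have hdet : ∀ b : Fin r ↪ E, ((Z.map (Int.cast : ℤ → ℝ)).submatrix id b).det =
        (((Z.submatrix id b).det : ℤ) : ℝ) := fun b =>
      (RingHom.map_det (Int.castRingHom ℝ) (Z.submatrix id b)).symm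
    refine ⟨r, Z.map Int.cast, hr,
      DetProb.isCoordinatization_of_isBase_range_iff hr fun b => ?_, fun b hb => ?_⟩
    · rw [hdet, (hZ b).2, Int.cast_ne_zero]
    -- A nonzero integer of absolute value at most 1 has absolute value exactly 1.
    · have h1 := le_antisymm (hZ b).1 (Int.one_le_abs ((hZ b).2.1 hb))
      rw [hdet, Real.norm_eq_abs]
      exact_mod_cast h1

theorem mainTheorem11 {E : Type u} [Fintype E] [DecidableEq E]
    (M : Matroid E) (hM : M.E = Set.univ) :
    ((∃ H : Submodule ℝ (EuclideanSpace ℝ E),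
        DetProb.Represents H M ∧ DetProb.detMeasure H = uniformOn {B : Set E | M.IsBase B}) ↔
      DetProb.IsRegular.{u, v} M) ∧
    ((∃ H : Submodule ℂ (EuclideanSpace ℂ E),
        DetProb.Represents H M ∧ DetProb.detMeasure H = uniformOn {B : Set E | M.IsBase B}) ↔
      DetProb.IsComplexUnimodular M) :=
  ⟨(DetProb.exists_represents_iff_isUnimodularOver M).trans
    (DetProb.isUnimodularOver_real_iff_isRegular M),
    -- `IsComplexUnimodular` is by definition `IsUnimodularOver ℂ`.
    DetProb.exists_represents_iff_isUnimodularOver M⟩
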